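/- Let $G=(V,E)$ be a finite simple graph. For $S\subseteq V$ write $G[S]$ for the induced subgraph. A set $F\subseteq V$ is a $4$-path vertex cover of $G$ if $G[V\setminus F]$ contains no path on $4$ vertices as a (not necessarily induced) subgraph; $\psi_4(G)$ is the minimum cardinality of a $4$-path vertex cover, and a cover attaining it is called optimal. The problem P4VC asks for an optimal $4$-path vertex cover. On a $d$-regular graph $G$ with $d\ge 4$ even, the algorithm Approx2 works as follows. (1) Starting from $V_1=\emptyset$, it repeatedly adds to $V_1$ an arbitrary vertex that has degree $d$ in $G[V\setminus V_1]$, until there is none. (2) For $i=2,\dots,d-2$ in this order, starting from $V_i=\emptyset$, it repeatedly adds to $V_i$ an arbitrary vertex that has degree $d-i+1$ in $G[V\setminus (V_1\cup\dots\cup V_i)]$, until there is none. (3) It sets $V_{d-1}=V\setminus(V_1\cup\dots\cup V_{d-2})$ and computes an arbitrary optimal $4$-path vertex cover $U_{d-1}$ of $G[V_{d-1}]$. (4) It returns a smallest one of the sets $U_{d-1}\cup V_1\cup\dots\cup V_{d-2}$ and $V\setminus(V_{2i-1}\cup V_{2i})$, $i=1,\dots,\frac d2-1$. In particular, for $d=4$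 it returns the smaller one of $V_3$ and $U_3\cup V_1\cup V_2$. **Theorem 5.** On $4$-regular graphs, Approx2 is a $1.852$-approximation for P4VC: for every finite simple $4$-regular graph $G$, the algorithm produces an output, and, whatever choices it makes, its output $A$ is a $4$-path vertex cover of $G$ with $|A|\le 1.852\,\psi_4(G)$. -/

import Mathlib

open Finset

namespace PathCover

/-- `F` is a `k`-path vertex cover of `G`: the induced subgraph `G[V - F]` contains no path on
`k` vertices (as a not necessarily induced subgraph). -/
def IsCover {V : Type*} (G : SimpleGraph V) (k : ℕ) (F : Finset V) : Prop :=
  (SimpleGraph.pathGraph k).Free (G.induce ((F : Set V)ᶜ))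

/-- `F` is an optimal, that is minimum, `k`-path vertex cover of `G`. -/
def IsMinCover {V : Type*} (G : SimpleGraph V) (k : ℕ) (F : Finset V) : Prop :=
  IsCover G k F ∧ ∀ F' : Finset V, IsCover G k F' → #F ≤ #F'

/-- The minimum cardinality `ψ_k(G)` of a `k`-path vertex cover of `G`. -/
noncomputable def psi {V : Type*} (G : SimpleGraph V) (k : ℕ) : ℕ :=
  sInf {n : ℕ | ∃ F : Finset V, IsCover G k F ∧ #F = n}

/-- The set of all vertices is a cover, so the infimum in `psi` is over a non-empty set. -/
theorem isCover_univ {V : Type*} [Fintype V] (G : SimpleGraph V) {k : ℕ} (hk : 0 < k) :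
    IsCover G k (Finset.univ : Finset V) := by
  rintro ⟨f⟩
  exact (f ⟨0, hk⟩).2 (by simp)

/-- The value `psi G k` is attained by a minimum cover. -/
theorem exists_isMinCover {V : Type*} [Fintype V] (G : SimpleGraph V) {k : ℕ} (hk : 0 < k) :
    ∃ F : Finset V, IsMinCover G k F ∧ #F = psi G k := by
  obtain ⟨F, hF, hc⟩ := Nat.sInf_mem
    (s := {n : ℕ | ∃ F : Finset V, IsCover G k F ∧ #F = n}) ⟨_, _, isCover_univ G hk, rfl⟩
  exact ⟨F, ⟨hF, fun F' hF' => hc ▸ Nat.sInf_le ⟨F', hF', rfl⟩⟩, hc⟩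

/-- The degree of a vertex `v ∈ R` in the induced subgraph `G[R]`. -/
def degreeIn {V : Type*} (G : SimpleGraph V) [DecidableRel G.Adj] (R : Finset V) (v : V) : ℕ :=
  #{w ∈ R | G.Adj v w}

/-- `GreedyPhase G δ R W`: some run of the following procedure, started on the remaining graph
`G[R]`, selects exactly the vertices of `W`. As long as the remaining graph has a vertex of degree
exactly `δ`, select any such vertex and delete it from the remaining graph. The run ends when there is
no vertex of degree `δ` left. -/
inductive GreedyPhase {V : Type*} [DecidableEq V] (G : SimpleGraph V) [DecidableRel G.Adj]
    (δ : ℕ) : Finset V → Finset V → Prop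
  | done (R : Finset V) (h : ∀ v ∈ R, degreeIn G R v ≠ δ) : GreedyPhase G δ R ∅
  | select (R W : Finset V) (v : V) (hv : v ∈ R) (hdeg : degreeIn G R v = δ)
      (hrun : GreedyPhase G δ (R.erase v) W) : GreedyPhase G δ R (insert v W)

/-- The vertices outside the sets `W a, W (a + 1), …, W b`. -/
def outside {V : Type*} [Fintype V] [DecidableEq V] (W : ℕ → Finset V) (a b : ℕ) : Finset V :=
  Finset.univ \ (Finset.Icc a b).biUnion W

/-- The covers compared by the algorithm when the selected sets are `W 1, …, W (d - 2)` and `U`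
is the cover of the last remaining graph: the set `U ∪ W 1 ∪ … ∪ W (d - 2)`, and the sets
`V - (W (2 i - 1) ∪ W (2 i))` for `i = 1, …, d / 2 - 1`. -/
def candidates {V : Type*} [Fintype V] [DecidableEq V] (d : ℕ) (W : ℕ → Finset V)
    (U : Finset V) : Finset (Finset V) :=
  insert (U ∪ (Finset.Icc 1 (d - 2)).biUnion W)
    ((Finset.Icc 1 (d / 2 - 1)).image fun i => Finset.univ \ (W (2 * i - 1) ∪ W (2 * i)))

/-- `A` is a possible output of the algorithm Approx2 on the `d`-regular graph `G` (`d ≥ 4` even):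
* for `i = 1, …, d - 2` in this order, `W i` is selected greedily from the vertices of degree
  `d - i + 1` in the graph that remains after deleting `W 1, …, W (i - 1)`;
* `U` is an optimal 4-path vertex cover of the last remaining graph
  `G[V - (W 1 ∪ … ∪ W (d - 2))]`;
* `A` is a smallest one of the candidate covers.
All the choices (of a vertex of the right degree, of `U`, of a smallest candidate) are arbitrary. -/
def IsApprox2Output {V : Type*} [Fintype V] [DecidableEq V] (G : SimpleGraph V)
    [DecidableRel G.Adj] (d : ℕ) (A : Finset V) : Prop :=
  ∃ (W : ℕ → Finset V) (U : Finset ((outside W 1 (d - 2) : Finset V) : Set V)),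
    (∀ i ∈ Finset.Icc 1 (d - 2), GreedyPhase G (d - i + 1) (outside W 1 (i - 1)) (W i)) ∧
    IsMinCover (G.induce ((outside W 1 (d - 2) : Finset V) : Set V)) 4 U ∧
    A ∈ candidates d W (U.map (Function.Embedding.subtype _)) ∧
    ∀ C ∈ candidates d W (U.map (Function.Embedding.subtype _)), #A ≤ #C

end PathCover

/-! Let `F` be an optimal cover and `S` the set V₃. Greedy selection forces G[S] to have maximum
degree at most 2 and makes G[V₁ ∪ V₂] free of 4-paths, so V₃ is a cover
(`noP4_union_of_greedyPhases`). Put R = V \ F and T = S \ F, and split F ∩ S into an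
inclusion-minimal cover U of G[S] and the rest D. The key inequality is 15(|V₁ ∪ V₂| + |U|) + 12|S|
≤ 50|F| (`exists_noP4_sdiff_card_le`). The output is no larger than either candidate, so weighting
these by 15 and 12 gives the ratio 50/27 < 1.852.

The inequality comes from two discharging arguments that share the function `charge` on T. The
components of G[R] are triangles, stars, single edges and isolated vertices; this sparsity bounds
the total charge (`sum_charge_le`). In G[S], each f in U lies on a 4-path whose other vertices are
in T ∪ D, and the charge of T, the edges inside U ∪ D and a loan of 12 per vertex of D suffice to
pay 48 to each f (`card_le_add_sum_charge`). By 4-regularity, the degree sums inside R and F differ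
by 4|R| - 4|F| (`sum_degreeIn_sub_compl`), which eliminates all edge terms. -/

namespace PathCover

/-! ### Sets without 4-paths and greedy phases -/

section

variable {V : Type*}

/-- The subgraph induced by `X` contains no path on four vertices. -/
def NoP4 (G : SimpleGraph V) (X : Finset V) : Prop :=
  ∀ a ∈ X, ∀ b ∈ X, ∀ c ∈ X, ∀ d ∈ X, G.Adj a b → G.Adj b c → G.Adj c d →
    a ≠ c → b ≠ d → a ≠ d → False

theorem noP4_mono {G : SimpleGraph V} {X Y : Finset V} (h : X ⊆ Y) (hY : NoP4 G Y) : NoP4 G X :=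
  fun a ha b hb c hc d hd => hY a (h ha) b (h hb) c (h hc) d (h hd)

theorem free_pathGraph_four_iff {α : Type*} (H : SimpleGraph α) :
    (SimpleGraph.pathGraph 4).Free H ↔
      ∀ a b c d, H.Adj a b → H.Adj b c → H.Adj c d → a ≠ c → b ≠ d → a ≠ d → False := by
  constructor
  · intro h a b c d hab hbc hcd hac hbd had
    have nab := hab.ne
    have nbc := hbc.ne
    have ncd := hcd.ne
    refine h ⟨⟨⟨![a, b, c, d], ?_⟩, ?_⟩⟩
    · intro x y hxy
      rw [SimpleGraph.pathGraph_adj] at hxy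
      fin_cases x <;> fin_cases y <;> simp_all [SimpleGraph.adj_comm]
    · intro x y hxy
      fin_cases x <;> fin_cases y <;> simp_all
  · rintro h ⟨f⟩
    have hadj : ∀ i j : Fin 4, i.val + 1 = j.val → H.Adj (f i) (f j) := fun i j hij =>
      f.toHom.map_adj (SimpleGraph.pathGraph_adj.2 (Or.inl hij))
    have hne : ∀ i j : Fin 4, i ≠ j → f i ≠ f j := fun i j hij h => hij (f.injective h)
    exact h (f 0) (f 1) (f 2) (f 3) (hadj _ _ rfl) (hadj _ _ rfl) (hadj _ _ rfl)
      (hne _ _ (by decide)) (hne _ _ (by decide)) (hne _ _ (by decide))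

theorem isCover_four_iff [Fintype V] [DecidableEq V] (G : SimpleGraph V) (F : Finset V) :
    IsCover G 4 F ↔ NoP4 G (univ \ F) := by
  rw [IsCover, free_pathGraph_four_iff]
  constructor
  · intro h a ha b hb c hc d hd hab hbc hcd hac hbd had
    simp only [mem_sdiff, mem_univ, true_and] at ha hb hc hd
    exact h ⟨a, by simpa using ha⟩ ⟨b, by simpa using hb⟩ ⟨c, by simpa using hc⟩
      ⟨d, by simpa using hd⟩ hab hbc hcd (by simpa using hac) (by simpa using hbd)
      (by simpa using had)
  · rintro h ⟨a, ha⟩ ⟨b, hb⟩ ⟨c, hc⟩ ⟨d, hd⟩ hab hbc hcd hac hbd had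
    exact h a (by simpa using ha) b (by simpa using hb) c (by simpa using hc) d (by simpa using hd)
      hab hbc hcd (by simpa using hac) (by simpa using hbd) (by simpa using had)

theorem isCover_induce_four_iff [DecidableEq V] (G : SimpleGraph V) (S : Finset V)
    (U : Finset (S : Set V)) :
    IsCover (G.induce (S : Set V)) 4 U ↔
      NoP4 G (S \ U.map (Function.Embedding.subtype _)) := by
  rw [IsCover, free_pathGraph_four_iff]
  constructor
  · intro h a ha b hb c hc d hd hab hbc hcd hac hbd had
    have key : ∀ x ∈ S \ U.map (Function.Embedding.subtype _), ∃ hx : x ∈ (S : Set V),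
        (⟨x, hx⟩ : (S : Set V)) ∈ ((U : Set (S : Set V))ᶜ) := by
      intro x hx
      simp only [mem_sdiff, mem_map, not_exists, not_and] at hx
      exact ⟨hx.1, fun hU => hx.2 _ hU rfl⟩
    obtain ⟨a1, a2⟩ := key a ha
    obtain ⟨b1, b2⟩ := key b hb
    obtain ⟨c1, c2⟩ := key c hc
    obtain ⟨d1, d2⟩ := key d hd
    exact h ⟨_, a2⟩ ⟨_, b2⟩ ⟨_, c2⟩ ⟨_, d2⟩ hab hbc hcd (by simpa using hac)
      (by simpa using hbd) (by simpa using had)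
  · rintro h ⟨⟨a, ha⟩, ha'⟩ ⟨⟨b, hb⟩, hb'⟩ ⟨⟨c, hc⟩, hc'⟩ ⟨⟨d, hd⟩, hd'⟩ hab hbc hcd hac hbd had
    have key : ∀ (x : V) (hx : x ∈ (S : Set V)),
        (⟨x, hx⟩ : (S : Set V)) ∈ ((U : Set (S : Set V))ᶜ) →
          x ∈ S \ U.map (Function.Embedding.subtype _) := by
      intro x hx hxU
      simp only [mem_sdiff, mem_map, not_exists, not_and]
      refine ⟨hx, ?_⟩
      rintro y hy rfl
      exact hxU hy
    exact h a (key a ha ha') b (key b hb hb') c (key c hc hc') d (key d hd hd') hab hbc hcd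
      (by simpa using hac) (by simpa using hbd) (by simpa using had)

variable {G : SimpleGraph V} [DecidableRel G.Adj]

theorem degreeIn_mono {R S : Finset V} (h : R ⊆ S) (v : V) : degreeIn G R v ≤ degreeIn G S v :=
  card_le_card (filter_subset_filter _ h)

variable [DecidableEq V]

theorem degreeIn_sdiff_add {R W : Finset V} (h : W ⊆ R) (v : V) :
    degreeIn G (R \ W) v + degreeIn G W v = degreeIn G R v := by
  unfold degreeIn
  rw [← card_union_of_disjoint (disjoint_filter_filter sdiff_disjoint), ← filter_union,
    sdiff_union_of_subset h]

theorem degreeIn_erase_add_one {R : Finset V} {v w : V} (hv : v ∈ R) (h : G.Adj w v) :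
    degreeIn G (R.erase v) w + 1 = degreeIn G R w := by
  unfold degreeIn
  rw [filter_erase, card_erase_add_one]
  simp [hv, h]

theorem exists_greedyPhase (δ : ℕ) (R : Finset V) : ∃ W, GreedyPhase G δ R W := by
  induction R using Finset.strongInduction with
  | H R ih =>
    by_cases h : ∃ v ∈ R, degreeIn G R v = δ
    · obtain ⟨v, hv, hd⟩ := h
      obtain ⟨W, hW⟩ := ih _ (erase_ssubset hv)
      exact ⟨_, .select R W v hv hd hW⟩
    · exact ⟨∅, .done R (by simpa using h)⟩

theorem GreedyPhase.subset {δ : ℕ} {R W : Finset V} (h : GreedyPhase G δ R W) : W ⊆ R := by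
  induction h with
  | done => simp
  | select R W v hv _ _ ih =>
    exact insert_subset hv (ih.trans (erase_subset _ _))

theorem GreedyPhase.degreeIn_ne {δ : ℕ} {R W : Finset V} (h : GreedyPhase G δ R W) :
    ∀ v ∈ R \ W, degreeIn G (R \ W) v ≠ δ := by
  induction h with
  | done R h => simpa using h
  | select R W v hv _ _ ih =>
    rwa [erase_sdiff_comm, ← sdiff_insert] at ih

/-- Since δ bounds all degrees, deleting a selected vertex pushes its neighbours below δ for good,
so none of them is selected later. Hence a selected vertex loses no neighbour to the phase. -/
theorem GreedyPhase.degreeIn_eq {δ : ℕ} {R W : Finset V} (h : GreedyPhase G δ R W)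
    (hR : ∀ v ∈ R, degreeIn G R v ≤ δ) :
    (∀ v ∈ W, ∀ w ∈ W, ¬G.Adj v w) ∧ ∀ v ∈ W, degreeIn G (R \ W) v = δ := by
  induction h with
  | done => simp
  | select R W v hv hd hrun ih =>
    obtain ⟨ih1, ih2⟩ := ih fun w hw =>
      (degreeIn_mono (erase_subset _ _) w).trans (hR w (mem_of_mem_erase hw))
    have hset : R \ insert v W = R.erase v \ W := by
      rw [erase_sdiff_comm, ← sdiff_insert]
    have hvW : ∀ w ∈ W, ¬G.Adj w v := by
      intro w hw hadj
      have h1 := degreeIn_erase_add_one hv hadj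
      have h2 := degreeIn_mono (G := G) (sdiff_subset (s := R.erase v) (t := W)) w
      have h3 := hR w (mem_of_mem_erase (hrun.subset hw))
      have h4 := ih2 w hw
      omega
    have hind : ∀ x ∈ insert v W, ∀ w ∈ insert v W, ¬G.Adj x w := by
      intro x hx w hw
      rcases mem_insert.1 hx with rfl | hxW <;> rcases mem_insert.1 hw with rfl | hwW
      · exact G.loopless.irrefl _
      · exact fun h => hvW w hwW h.symm
      · exact hvW x hxW
      · exact ih1 x hxW w hwW
    refine ⟨hind, fun x hx => ?_⟩
    rcases mem_insert.1 hx with rfl | hxW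
    · rw [← hd, ← degreeIn_sdiff_add (insert_subset hv (hrun.subset.trans (erase_subset _ _)))]
      have : degreeIn G (insert x W) x = 0 := by
        simp only [degreeIn, card_eq_zero, filter_eq_empty_iff]
        exact fun w hw => hind x hx w hw
      omega
    · rw [hset]
      exact ih2 x hxW

end

/-! ### Discharging on the complement of a cover -/

section

variable {V : Type*} {G : SimpleGraph V} [DecidableRel G.Adj]

/-- Conservation law for both discharging arguments: whatever one end of an edge sends, the other
end receives. -/
theorem sum_sub_swap_eq_zero (R : Finset V) (q : V → V → ℤ) :
    ∑ v ∈ R, ∑ w ∈ R with G.Adj v w, (q w v - q v w) = 0 := by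
  simp only [sum_sub_distrib, sum_filter]
  rw [sub_eq_zero, sum_comm]
  simp only [G.adj_comm]

variable (G) in
open Classical in
/-- The charge guaranteed to a vertex of `T` by its neighbours in `T`. -/
noncomputable def charge (T : Finset V) (r : V) : ℤ :=
  if degreeIn G T r = 0 then 42 else if degreeIn G T r = 2 then 0
  else if ∃ y ∈ T, G.Adj r y ∧ degreeIn G T y = 2 then 48 else 27

theorem charge_le (T : Finset V) (r : V) : charge G T r ≤ 48 := by
  unfold charge; split_ifs <;> norm_num

theorem charge_of_degreeIn_eq_zero {T : Finset V} {r : V} (h : degreeIn G T r = 0) :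
    charge G T r = 42 := by
  simp [charge, h]

theorem charge_of_degreeIn_eq_two {T : Finset V} {r : V} (h : degreeIn G T r = 2) :
    charge G T r = 0 := by
  simp [charge, h]

theorem charge_le_of_forall_ne {T : Finset V} {r : V} (h0 : degreeIn G T r ≠ 0)
    (h : ∀ y ∈ T, G.Adj r y → degreeIn G T y ≠ 2) : charge G T r ≤ 27 := by
  unfold charge
  rw [if_neg h0]
  split_ifs with h2 h3
  · norm_num
  · obtain ⟨y, hy, hry, hy2⟩ := h3
    exact absurd hy2 (h y hy hry)
  · norm_num

variable [DecidableEq V]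

/-- A connected graph without paths on four vertices is a triangle or a star. -/
theorem NoP4.triangle_or_star {R : Finset V} (h : NoP4 G R) {v : V} (hv : v ∈ R)
    (hd : 2 ≤ #{w ∈ R | G.Adj v w}) :
    (∃ w x, w ≠ x ∧ {y ∈ R | G.Adj v y} = {w, x} ∧ {y ∈ R | G.Adj w y} = {v, x} ∧
      {y ∈ R | G.Adj x y} = {v, w}) ∨
    ∀ w ∈ R, G.Adj v w → {y ∈ R | G.Adj w y} = {v} := by
  by_contra! hc
  obtain ⟨hc1, w, hw, hvw, hNw⟩ := hc
  have : ∃ y ∈ R, G.Adj w y ∧ y ≠ v := by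
    by_contra! hcon
    apply hNw
    ext y
    simp only [mem_filter, mem_singleton]
    exact ⟨fun h => hcon y h.1 h.2, fun h => h ▸ ⟨hv, hvw.symm⟩⟩
  obtain ⟨y, hy, hwy, hyv⟩ := this
  have hsub : {z ∈ R | G.Adj v z} ⊆ {w, y} := by
    intro z hz
    simp only [mem_filter, mem_insert, mem_singleton] at hz ⊢
    by_contra! hzz
    exact h z hz.1 v hv w hw y hy hz.2.symm hvw hwy hzz.1 hyv.symm hzz.2
  have heq := eq_of_subset_of_card_le hsub ((card_le_two).trans hd)
  have hvy : G.Adj v y := by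
    have : y ∈ {z ∈ R | G.Adj v z} := by rw [heq]; simp
    exact (mem_filter.1 this).2
  refine hc1 w y hwy.ne heq ?_ ?_
  · ext z
    simp only [mem_filter, mem_insert, mem_singleton]
    constructor
    · rintro ⟨hz, hwz⟩
      by_contra! hzz
      exact h z hz w hw v hv y hy hwz.symm hvw.symm hvy hzz.1 hwy.ne hzz.2
    · rintro (rfl | rfl)
      exacts [⟨hv, hvw.symm⟩, ⟨hy, hwy⟩]
  · ext z
    simp only [mem_filter, mem_insert, mem_singleton]
    constructor
    · rintro ⟨hz, hyz⟩
      by_contra! hzz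
      exact h z hz y hy v hv w hw hyz.symm hvy.symm hvw hzz.1 hwy.ne' hzz.2
    · rintro (rfl | rfl)
      exacts [⟨hv, hvy.symm⟩, ⟨hw, hwy.symm⟩]

variable (G) in
/-- What `v` gives to an adjacent vertex `w` of the graph induced by `R`. -/
def gift (R T : Finset V) (v w : V) : ℤ :=
  if degreeIn G R v = 1 ∧ 2 ≤ degreeIn G R w then
    if w ∉ T then 15 else if v ∉ T then 35 else 5
  else if 2 ≤ degreeIn G R v ∧ 2 ≤ degreeIn G R w ∧ v ∉ T ∧ w ∈ T then
    if degreeIn G T w = 0 then 10 else 5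
  else 0

/-- A vertex starts with 92 if it is in `T` and 80 otherwise, and loses 35 per incident edge. In
stars the leaves support the centre; in triangles the vertices outside `T` support those in `T`. -/
theorem charge_le_add_gifts {R T : Finset V} (hTR : T ⊆ R) (h : NoP4 G R)
    (hR : ∀ v ∈ R, degreeIn G R v ≤ 4) (hT : ∀ v ∈ T, degreeIn G T v ≤ 2) {v : V} (hv : v ∈ R) :
    (if v ∈ T then charge G T v else 0) ≤ (if v ∈ T then 22 else 10) + 70 - 35 * degreeIn G R v +
      ∑ w ∈ R with G.Adj v w, (gift G R T w v - gift G R T v w) := by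
  have hj : ∀ x, degreeIn G T x = #{y ∈ {y ∈ R | G.Adj x y} | y ∈ T} := by
    intro x
    unfold degreeIn
    congr 1
    ext y
    simp only [mem_filter]
    exact ⟨fun h => ⟨⟨hTR h.1, h.2⟩, h.1⟩, fun h => ⟨h.2, h.1.2⟩⟩
  rcases lt_or_ge (degreeIn G R v) 2 with hlt | hge
  · obtain h0 | h1 : degreeIn G R v = 0 ∨ degreeIn G R v = 1 := by omega
    · have hN : {w ∈ R | G.Adj v w} = ∅ := card_eq_zero.1 h0
      rw [hN, h0]
      have := charge_le (G := G) T v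
      simp only [sum_empty]
      split_ifs <;> (simp; try omega)
    · obtain ⟨w, hN⟩ := card_eq_one.1 h1
      have hw : w ∈ R ∧ G.Adj v w := by
        have : w ∈ {w ∈ R | G.Adj v w} := by rw [hN]; simp
        simpa using this
      have hle := charge_le (G := G) T v
      -- A leaf of `T` that gives 15 to a centre outside `T` keeps 92 - 35 - 15 = 42, so the bound
      -- 48 would not do here.
      have h42 : w ∉ T → charge G T v = 42 := by
        intro hwT
        apply charge_of_degreeIn_eq_zero
        rw [hj, hN]
        simp [filter_singleton, hwT]
      rw [hN, sum_singleton, h1]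
      by_cases hw2 : 2 ≤ degreeIn G R w
      · by_cases hvT : v ∈ T <;> by_cases hwT : w ∈ T <;>
          simp [gift, h1, hw2, hvT, hwT] at * <;> omega
      · by_cases hvT : v ∈ T <;> (simp [gift, h1, hw2, hvT]; try omega)
  · rcases h.triangle_or_star hv hge with ⟨w, x, hwx, hNv, hNw, hNx⟩ | hstar
    · have hw : w ∈ R ∧ G.Adj v w := by
        have : w ∈ {w ∈ R | G.Adj v w} := by rw [hNv]; simp
        simpa using this
      have hx : x ∈ R ∧ G.Adj v x := by
        have : x ∈ {w ∈ R | G.Adj v w} := by rw [hNv]; simp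
        simpa using this
      have hvw := hw.2.ne
      have hvx := hx.2.ne
      have dv : degreeIn G R v = 2 := by unfold degreeIn; rw [hNv, card_pair hwx]
      have dw : degreeIn G R w = 2 := by unfold degreeIn; rw [hNw, card_pair hvx]
      have dx : degreeIn G R x = 2 := by unfold degreeIn; rw [hNx, card_pair hvw]
      have jv : degreeIn G T v = (if w ∈ T then 1 else 0) + (if x ∈ T then 1 else 0) := by
        rw [hj, hNv, card_filter, sum_pair hwx]
      have jw : degreeIn G T w = (if v ∈ T then 1 else 0) + (if x ∈ T then 1 else 0) := by
        rw [hj, hNw, card_filter, sum_pair hvx]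
      have jx : degreeIn G T x = (if v ∈ T then 1 else 0) + (if w ∈ T then 1 else 0) := by
        rw [hj, hNx, card_filter, sum_pair hvw]
      -- With exactly two triangle vertices in `T`, each has degree 1 in `T`, which excludes the
      -- value 48; 27 is what remains of 92 - 70 plus the gift 5.
      have h27 : degreeIn G T v = 1 → v ∈ T → charge G T v ≤ 27 := by
        intro h1 hvT
        apply charge_le_of_forall_ne (by omega)
        intro y hy hvy
        have : y ∈ {w ∈ R | G.Adj v w} := by simp [hTR hy, hvy]
        rw [hNv, mem_insert, mem_singleton] at this
        rcases this with rfl | rfl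
        · rw [jw, if_pos hvT]; rw [h1, if_pos hy] at jv; split_ifs at jv ⊢ <;> omega
        · rw [jx, if_pos hvT]; rw [h1, if_pos hy] at jv; split_ifs at jv ⊢ <;> omega
      have h0 := charge_of_degreeIn_eq_zero (G := G) (T := T) (r := v)
      have h2 := charge_of_degreeIn_eq_two (G := G) (T := T) (r := v)
      rw [hNv, sum_pair hwx]
      unfold gift
      rw [dv, dw, dx, jw, jx]
      rw [jv] at h0 h2 h27 ⊢
      clear jv jw jx
      by_cases hvT : v ∈ T <;> by_cases hwT : w ∈ T <;> by_cases hxT : x ∈ T <;>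
        simp [hvT, hwT, hxT] at h0 h2 h27 ⊢ <;> omega
    · have hsum : ∑ w ∈ R with G.Adj v w, (gift G R T w v - gift G R T v w) =
          ∑ w ∈ R with G.Adj v w, if v ∉ T then 15 else 35 - 30 * if w ∈ T then 1 else 0 := by
        apply sum_congr rfl
        intro w hw
        simp only [mem_filter] at hw
        have dw : degreeIn G R w = 1 := by unfold degreeIn; rw [hstar w hw.1 hw.2, card_singleton]
        by_cases hvT : v ∈ T <;> by_cases hwT : w ∈ T <;> simp [gift, dw, hge, hvT, hwT]
      rw [hsum]
      by_cases hvT : v ∈ T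
      · have hjv : ∑ w ∈ R with G.Adj v w, (if w ∈ T then 1 else 0 : ℤ) = degreeIn G T v := by
          rw [hj, card_filter]; push_cast; rfl
        have hcard : (#{w ∈ R | G.Adj v w} : ℤ) = degreeIn G R v := rfl
        simp only [hvT, not_true_eq_false, if_false, if_true, sum_sub_distrib, ← mul_sum, hjv,
          sum_const, hcard, nsmul_eq_mul]
        have := hT v hvT
        have hle := charge_le (G := G) T v
        have h2 := charge_of_degreeIn_eq_two (G := G) (T := T) (r := v)
        obtain h0 | h1 | h3 : degreeIn G T v = 0 ∨ degreeIn G T v = 1 ∨ degreeIn G T v = 2 := by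
          omega
        · rw [h0]; push_cast; linarith
        · rw [h1]; push_cast; linarith
        · rw [h2 h3, h3]; push_cast; linarith
      · have hcard : (#{w ∈ R | G.Adj v w} : ℤ) = degreeIn G R v := rfl
        -- A centre outside `T` with k leaves retains 80 - 35k + 15k = 80 - 20k, which is
        -- nonnegative because k ≤ 4.
        have := hR v hv
        simp only [hvT, not_false_eq_true, if_true, if_false, sum_const, hcard, nsmul_eq_mul]
        omega

theorem sum_charge_le {R T : Finset V} (hTR : T ⊆ R) (h : NoP4 G R)
    (hR : ∀ v ∈ R, degreeIn G R v ≤ 4) (hT : ∀ v ∈ T, degreeIn G T v ≤ 2) :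
    ∑ v ∈ T, charge G T v ≤ 80 * (#R : ℤ) + 12 * #T - 35 * ∑ v ∈ R, (degreeIn G R v : ℤ) := by
  have h1 := sum_le_sum fun v hv => charge_le_add_gifts hTR h hR hT (v := v) hv
  rw [sum_add_distrib, sum_sub_swap_eq_zero, add_zero] at h1
  have h2 : ∑ v ∈ R, (if v ∈ T then charge G T v else 0) = ∑ v ∈ T, charge G T v := by
    rw [← sum_filter, filter_mem_eq_inter, inter_eq_right.2 hTR]
  have h3 : ∑ v ∈ R, ((if v ∈ T then 22 else 10) + 70 - 35 * (degreeIn G R v : ℤ)) =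
      80 * (#R : ℤ) + 12 * #T - 35 * ∑ v ∈ R, (degreeIn G R v : ℤ) := by
    have : ∀ v ∈ R, ((if v ∈ T then 22 else 10) + 70 - 35 * (degreeIn G R v : ℤ)) =
        80 + 12 * (if v ∈ T then 1 else 0) - 35 * (degreeIn G R v : ℤ) := by
      intro v _
      split_ifs <;> ring
    rw [sum_congr rfl this, sum_sub_distrib, sum_add_distrib, ← mul_sum, ← mul_sum, ← sum_filter,
      filter_mem_eq_inter, inter_eq_right.2 hTR]
    simp
    ring
  rw [h2, h3] at h1
  exact h1

end

/-! ### Discharging on the remaining graph of maximum degree two -/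

section

variable {V : Type*} {G : SimpleGraph V} [DecidableRel G.Adj]

variable (G) in
/-- `x` has a neighbour in `D`. -/
def HasNeighbor (D : Finset V) (x : V) : Prop := ∃ d ∈ D, G.Adj x d

variable (G) in
/-- `x` has a neighbour in `T` that has two neighbours in `T` or a neighbour in `D`. -/
def HasRichNeighbor (T D : Finset V) (x : V) : Prop :=
  ∃ z ∈ T, G.Adj x z ∧ (degreeIn G T z = 2 ∨ HasNeighbor G D z)

variable (G) in
open Classical in
/-- What `x` pays to an adjacent vertex `y` of the graph induced by `T ∪ U ∪ D`. -/
noncomputable def payment (T U D : Finset V) (x y : V) : ℤ :=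
  if x ∈ T then
    if y ∈ U then
      if HasNeighbor G D x ∨ HasRichNeighbor G T D x then 48
      else if degreeIn G T x = 0 then 21 else 27
    else if y ∈ T ∧ degreeIn G T x = 1 ∧ degreeIn G T y = 1 ∧ HasNeighbor G D x ∧
      ¬HasNeighbor G D y then 21
    else 0
  else if x ∈ D then if y ∈ U then 13 else if y ∈ T then 6 else 0
  else 0

theorem payment_nonneg (T U D : Finset V) (x y : V) : 0 ≤ payment G T U D x y := by
  unfold payment; split_ifs <;> norm_num

theorem payment_eq_of_rich {T U D : Finset V} {x y : V} (hx : x ∈ T) (hy : y ∈ U)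
    (h : HasNeighbor G D x ∨ HasRichNeighbor G T D x) : payment G T U D x y = 48 := by
  simp [payment, hx, hy, h]

theorem le_payment {T U D : Finset V} {x y : V} (hx : x ∈ T) (hy : y ∈ U) :
    21 ≤ payment G T U D x y := by
  simp only [payment, hx, hy, if_true]; split_ifs <;> norm_num

theorem le_payment_of_degreeIn_ne_zero {T U D : Finset V} {x y : V} (hx : x ∈ T) (hy : y ∈ U)
    (h : degreeIn G T x ≠ 0) : 27 ≤ payment G T U D x y := by
  simp only [payment, hx, hy, h, if_true, if_false]; split_ifs <;> norm_num

variable [DecidableEq V]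

variable (G) in
/-- What `y` receives from an adjacent vertex `x`, including its half of an edge of `U ∪ D`. -/
noncomputable def income (T U D : Finset V) (x y : V) : ℤ :=
  35 * (if x ∈ U ∪ D then 1 else 0) + payment G T U D x y

theorem income_nonneg (T U D : Finset V) (x y : V) : 0 ≤ income G T U D x y := by
  have := payment_nonneg (G := G) T U D x y
  unfold income; split_ifs <;> omega

theorem payment_le_income (T U D : Finset V) (x y : V) :
    payment G T U D x y ≤ income G T U D x y := by
  unfold income; split_ifs <;> omega

theorem income_of_mem_dropped {T U D : Finset V} (hTD : Disjoint T D) {x y : V} (hx : x ∈ D)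
    (hy : y ∈ U) : income G T U D x y = 48 := by
  have : x ∉ T := fun h => disjoint_left.1 hTD h hx
  simp [income, payment, hx, hy, this]

theorem le_income {T U D : Finset V} (hTD : Disjoint T D) {x y : V} (hx : x ∈ T ∪ D)
    (hy : y ∈ U) : 21 ≤ income G T U D x y := by
  rcases mem_union.1 hx with hx | hx
  · exact (le_payment hx hy).trans (payment_le_income _ _ _ _ _)
  · rw [income_of_mem_dropped hTD hx hy]; norm_num

/-- A vertex `b` of `D` contributes 35 + 13. If `b ∈ T`, the continuation `c`, `d` makes it pay the
top rate: either `c ∈ D`, or `c` has a neighbour in `D`, or `b` and `d` are two neighbours of `c` in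
`T`. -/
theorem le_income_of_path_end {T U D : Finset V} (hTD : Disjoint T D)
    (hT : ∀ v ∈ T, degreeIn G T v ≤ 2) {f b c d : V} (hf : f ∈ U) (hb : b ∈ T ∪ D)
    (hc : c ∈ T ∪ D) (hd : d ∈ T ∪ D) (hbc : G.Adj b c) (hcd : G.Adj c d) (hbd : b ≠ d) :
    48 ≤ income G T U D b f := by
  rcases mem_union.1 hb with hb | hb
  · refine le_trans ?_ (payment_le_income _ _ _ _ _)
    rw [payment_eq_of_rich hb hf]
    rcases mem_union.1 hc with hc | hc
    · refine Or.inr ⟨c, hc, hbc, ?_⟩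
      rcases mem_union.1 hd with hd | hd
      · refine Or.inl ((hT c hc).antisymm ?_)
        rw [← card_pair hbd]
        apply card_le_card
        intro x hx
        rcases mem_insert.1 hx with rfl | hx
        · simp [hb, hbc.symm]
        · rw [mem_singleton.1 hx]; simp [hd, hcd]
      · exact Or.inr ⟨d, hd, hcd⟩
    · exact Or.inl ⟨c, hc, hbc⟩
  · exact (income_of_mem_dropped hTD hb hf).ge

theorem le_income_of_path_mid {T U D : Finset V} (hTD : Disjoint T D) {f c d : V} (hf : f ∈ U)
    (hc : c ∈ T ∪ D) (hd : d ∈ T ∪ D) (hcd : G.Adj c d) : 27 ≤ income G T U D c f := by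
  rcases mem_union.1 hc with hc | hc
  · refine le_trans ?_ (payment_le_income _ _ _ _ _)
    rcases mem_union.1 hd with hd | hd
    · apply le_payment_of_degreeIn_ne_zero hc hf
      exact (card_pos.2 ⟨d, by simp [hd, hcd]⟩).ne'
    · rw [payment_eq_of_rich hc hf (Or.inl ⟨d, hd, hcd⟩)]; norm_num
  · rw [income_of_mem_dropped hTD hc hf]; norm_num

/-- Essentiality of `f` gives a 4-path through `f` inside `insert f (T ∪ D)`. If `f` is an end, its
neighbour on the path gives 48; if `f` is inner, its two neighbours give at least 21 + 27. -/
theorem le_sum_income {S T U D : Finset V} (hS : S = T ∪ U ∪ D) (hTD : Disjoint T D)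
    (hT : ∀ v ∈ T, degreeIn G T v ≤ 2) (hcov : NoP4 G (T ∪ D)) {f : V} (hf : f ∈ U)
    (hess : ¬NoP4 G (insert f (T ∪ D))) :
    48 ≤ ∑ w ∈ S with G.Adj f w, income G T U D w f := by
  have hsub : ∀ x ∈ T ∪ D, x ∈ S := by
    intro x hx; rw [hS]; simp only [mem_union] at hx ⊢; tauto
  have one : ∀ b ∈ T ∪ D, ∀ c ∈ T ∪ D, ∀ d ∈ T ∪ D, G.Adj f b → G.Adj b c → G.Adj c d → b ≠ d →
      48 ≤ ∑ w ∈ S with G.Adj f w, income G T U D w f := by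
    intro b hb c hc d hd hfb hbc hcd hbd
    refine (le_income_of_path_end hTD hT hf hb hc hd hbc hcd hbd).trans ?_
    exact single_le_sum (f := fun w => income G T U D w f)
      (fun w _ => income_nonneg T U D w f) (mem_filter.2 ⟨hsub b hb, hfb⟩)
  have two : ∀ a ∈ T ∪ D, ∀ c ∈ T ∪ D, ∀ d ∈ T ∪ D, G.Adj f a → G.Adj f c → G.Adj c d → a ≠ c →
      48 ≤ ∑ w ∈ S with G.Adj f w, income G T U D w f := by
    intro a ha c hc d hd hfa hfc hcd hac
    have h1 := le_income (G := G) hTD ha hf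
    have h2 := le_income_of_path_mid hTD hf hc hd hcd
    calc (48 : ℤ) ≤ ∑ w ∈ {a, c}, income G T U D w f := by rw [sum_pair hac]; linarith
      _ ≤ _ := by
        apply sum_le_sum_of_subset_of_nonneg
        · intro x hx
          rcases mem_insert.1 hx with rfl | hx
          · exact mem_filter.2 ⟨hsub _ ha, hfa⟩
          · rw [mem_singleton.1 hx]; exact mem_filter.2 ⟨hsub _ hc, hfc⟩
        · exact fun w _ _ => income_nonneg T U D w f
  unfold NoP4 at hess
  push Not at hess
  obtain ⟨a, ha, b, hb, c, hc, d, hd, hab, hbc, hcd, hac, hbd, had, -⟩ := hess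
  have out : ∀ x ∈ insert f (T ∪ D), x ≠ f → x ∈ T ∪ D := fun x hx hxf =>
    (mem_insert.1 hx).resolve_left hxf
  by_cases haf : a = f
  · subst haf
    exact one b (out b hb hab.ne') c (out c hc hac.symm) d (out d hd had.symm) hab hbc hcd hbd
  have ha' := out a ha haf
  by_cases hbf : b = f
  · subst hbf
    exact two a ha' c (out c hc hbc.ne') d (out d hd hbd.symm) hab.symm hbc hcd hac
  have hb' := out b hb hbf
  by_cases hcf : c = f
  · subst hcf
    exact two d (out d hd hcd.ne') b hb' a ha' hcd hbc.symm hab.symm hbd.symm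
  have hc' := out c hc hcf
  by_cases hdf : d = f
  · subst hdf
    exact one c hc' b hb' a ha' hcd.symm hbc.symm hab.symm hac.symm
  exact (hcov a ha' b hb' c hc' d (out d hd hdf) hab hbc hcd hac hbd had).elim

/-- Solvency of `T`. A vertex isolated in `T` affords 21 + 21 = 42, or 48 = 42 + 6 next to a vertex
of `D`. A vertex of degree 1 in `T` has at most one neighbour in `U`; if it owes 48 but has charge
27, its neighbour in `T` sends the missing 21 out of 27 + 6. -/
theorem le_charge_add_payments {S T U D : Finset V} (hS : S = T ∪ U ∪ D) (hTU : Disjoint T U)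
    (hTD : Disjoint T D) (hUD : Disjoint U D) (hdeg : ∀ v ∈ S, degreeIn G S v ≤ 2) {v : V}
    (hv : v ∈ T) :
    0 ≤ charge G T v + ∑ w ∈ S with G.Adj v w, (payment G T U D w v - payment G T U D v w) := by
  have hTS : T ⊆ S := by rw [hS]; exact fun x hx => by simp [hx]
  have hDS : D ⊆ S := by rw [hS]; exact fun x hx => by simp [hx]
  have hj : degreeIn G T v = #{y ∈ {y ∈ S | G.Adj v y} | y ∈ T} := by
    unfold degreeIn
    congr 1
    ext y
    simp only [mem_filter]
    exact ⟨fun h => ⟨⟨hTS h.1, h.2⟩, h.1⟩, fun h => ⟨h.2, h.1.2⟩⟩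
  have hex : ∀ P : V → Prop, (∃ z ∈ T, G.Adj v z ∧ P z) ↔
      ∃ z ∈ ({y ∈ S | G.Adj v y} : Finset V), z ∈ T ∧ P z := by
    intro P
    simp only [mem_filter]
    exact ⟨fun ⟨z, h1, h2, h3⟩ => ⟨z, ⟨hTS h1, h2⟩, h1, h3⟩,
      fun ⟨z, h1, h2, h3⟩ => ⟨z, h2, h1.2, h3⟩⟩
  have hnear : HasNeighbor G D v ↔ ∃ z ∈ ({y ∈ S | G.Adj v y} : Finset V), z ∈ D := by
    unfold HasNeighbor
    simp only [mem_filter]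
    exact ⟨fun ⟨z, h1, h2⟩ => ⟨z, ⟨hDS h1, h2⟩, h1⟩, fun ⟨z, h1, h2⟩ => ⟨z, h2, h1.2⟩⟩
  have hpos : ∀ w ∈ T, G.Adj v w → degreeIn G T w = 1 ∨ degreeIn G T w = 2 := by
    intro w hw hvw
    have h1 : 0 < degreeIn G T w := card_pos.2 ⟨v, by simp [hv, hvw.symm]⟩
    have h2 := (degreeIn_mono (G := G) hTS w).trans (hdeg w (hTS hw))
    omega
  have tri : ∀ w ∈ S, G.Adj v w → (w ∈ T ∧ w ∉ U ∧ w ∉ D ∧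
      (degreeIn G T w = 1 ∨ degreeIn G T w = 2)) ∨ (w ∉ T ∧ w ∈ U ∧ w ∉ D) ∨
      (w ∉ T ∧ w ∉ U ∧ w ∈ D) := by
    intro w hw hvw
    rw [hS, mem_union, mem_union] at hw
    rcases hw with (hw | hw) | hw
    · exact Or.inl ⟨hw, disjoint_left.1 hTU hw, disjoint_left.1 hTD hw, hpos w hw hvw⟩
    · exact Or.inr (Or.inl ⟨disjoint_right.1 hTU hw, hw, disjoint_left.1 hUD hw⟩)
    · exact Or.inr (Or.inr ⟨disjoint_right.1 hTD hw, disjoint_right.1 hUD hw, hw⟩)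
  have hvU := disjoint_left.1 hTU hv
  have hvD := disjoint_left.1 hTD hv
  have hrich : HasRichNeighbor G T D v ↔ _ := hex _
  have htri : ∀ w ∈ ({y ∈ S | G.Adj v y} : Finset V), _ := fun w hw =>
    tri w (mem_filter.1 hw).1 (mem_filter.1 hw).2
  have hcard : #({y ∈ S | G.Adj v y} : Finset V) ≤ 2 := hdeg v (hTS hv)
  unfold charge payment
  simp only [hv, hvU, hvD, if_true, if_false, true_and]
  simp only [hex fun y => degreeIn G T y = 2, hrich, hnear]
  -- All conditions on `v` now refer only to its neighbourhood in `S`, which has at most two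
  -- elements, so a finite case analysis remains.
  generalize ({y ∈ S | G.Adj v y} : Finset V) = N at *
  obtain h0 | h1 | h2 : #N = 0 ∨ #N = 1 ∨ #N = 2 := by omega
  · rw [card_eq_zero.1 h0] at hj ⊢
    simp at hj
    simp [hj]
  · obtain ⟨x, rfl⟩ := card_eq_one.1 h1
    rcases htri x (by simp) with ⟨a1, a2, a3, a4 | a4⟩ | ⟨a1, a2, a3⟩ | ⟨a1, a2, a3⟩ <;>
      simp [filter_singleton, a1] at hj <;> simp [hv, hj, a1, a2, a3] <;>
      (try simp [a4]) <;> split_ifs <;> simp_all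
  · obtain ⟨x, y, hxy, rfl⟩ := card_eq_two.1 h2
    rw [card_filter, sum_pair hxy] at hj
    rw [sum_pair hxy]
    rcases htri x (by simp) with ⟨a1, a2, a3, a4 | a4⟩ | ⟨a1, a2, a3⟩ | ⟨a1, a2, a3⟩ <;>
    rcases htri y (by simp) with ⟨b1, b2, b3, b4 | b4⟩ | ⟨b1, b2, b3⟩ | ⟨b1, b2, b3⟩ <;>
      simp [a1, b1] at hj <;> simp [hv, hj, a1, a2, a3, b1, b2, b3] <;>
      (try simp [a4]) <;> (try simp [b4]) <;> split_ifs <;> simp_all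

end

/-! ### Minimal covers and the linear inequality -/

section

variable {V : Type*} {G : SimpleGraph V}

theorem exists_minimal_noP4 [DecidableEq V] {S : Finset V} (X : Finset V) (hXS : X ⊆ S) (hX : NoP4 G (S \ X)) :
    ∃ U ⊆ X, NoP4 G (S \ U) ∧ ∀ f ∈ U, ¬NoP4 G (insert f (S \ U)) := by
  induction X using Finset.strongInduction with
  | H X ih =>
    by_cases h : ∃ f ∈ X, NoP4 G (insert f (S \ X))
    · obtain ⟨f, hf, hP⟩ := h
      rw [← sdiff_erase (hXS hf)] at hP
      obtain ⟨U, hU, hU'⟩ := ih _ (erase_ssubset hf) ((erase_subset _ _).trans hXS) hP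
      exact ⟨U, hU.trans (erase_subset _ _), hU'⟩
    · push Not at h
      exact ⟨X, Subset.rfl, hX, h⟩

variable [DecidableRel G.Adj]

theorem degreeIn_univ [Fintype V] (v : V) : degreeIn G univ v = G.degree v := by
  unfold degreeIn
  rw [← G.card_neighborFinset_eq_degree, G.neighborFinset_eq_filter]

variable [DecidableEq V]

theorem sum_boole_eq_degreeIn {S X : Finset V} (h : X ⊆ S) (v : V) :
    ∑ w ∈ S with G.Adj v w, (if w ∈ X then 1 else 0 : ℤ) = degreeIn G X v := by
  unfold degreeIn
  rw [← sum_filter, card_eq_sum_ones, filter_filter]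
  push_cast
  congr 1
  ext w
  simp only [mem_filter]
  exact ⟨fun hw => ⟨hw.2.2, hw.2.1⟩, fun hw => ⟨h hw.1, hw.2, hw.1⟩⟩

theorem card_le_add_sum_charge {S T U D : Finset V} (hS : S = T ∪ U ∪ D) (hTU : Disjoint T U)
    (hTD : Disjoint T D) (hUD : Disjoint U D) (hdeg : ∀ v ∈ S, degreeIn G S v ≤ 2)
    (hcov : NoP4 G (T ∪ D)) (hess : ∀ f ∈ U, ¬NoP4 G (insert f (T ∪ D))) :
    48 * (#U : ℤ) ≤ 12 * #D + ∑ v ∈ T, charge G T v +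
      35 * ∑ v ∈ U ∪ D, (degreeIn G (U ∪ D) v : ℤ) := by
  have hXS : U ∪ D ⊆ S := by rw [hS, union_assoc]; exact subset_union_right
  have hTS : T ⊆ S := by rw [hS, union_assoc]; exact subset_union_left
  have hT : ∀ v ∈ T, degreeIn G T v ≤ 2 := fun v hv =>
    (degreeIn_mono hTS v).trans (hdeg v (hTS hv))
  have hU : ∀ v ∈ U, 48 ≤ 35 * (degreeIn G (U ∪ D) v : ℤ) +
      ∑ w ∈ S with G.Adj v w, (payment G T U D w v - payment G T U D v w) := by
    intro v hv
    refine (le_sum_income hS hTD hT hcov hv (hess v hv)).trans_eq ?_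
    rw [← sum_boole_eq_degreeIn hXS, mul_sum, ← sum_add_distrib]
    apply sum_congr rfl
    intro w _
    simp [income, payment, disjoint_right.1 hTU hv, disjoint_left.1 hUD hv]
  have hD : ∀ v ∈ D, -12 ≤ 35 * (degreeIn G (U ∪ D) v : ℤ) +
      ∑ w ∈ S with G.Adj v w, (payment G T U D w v - payment G T U D v w) := by
    intro v hv
    have hvT := disjoint_right.1 hTD hv
    have hvU := disjoint_right.1 hUD hv
    rw [← sum_boole_eq_degreeIn hXS, mul_sum, ← sum_add_distrib]
    have hcard : #{w ∈ S | G.Adj v w} ≤ 2 := hdeg v (hXS (mem_union_right _ hv))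
    -- Per neighbour, a vertex of `D` nets at least 35 - 13 towards `U`, 35 towards `D` and -6
    -- towards `T`; with at most two neighbours the loss is at most 12.
    have := card_nsmul_le_sum ({w ∈ S | G.Adj v w} : Finset V)
      (fun w => 35 * (if w ∈ U ∪ D then 1 else 0 : ℤ) +
        (payment G T U D w v - payment G T U D v w)) (-6) (by
        intro w _
        by_cases hwU : w ∈ U
        · simp [payment, hvT, hvU, hv, hwU]
        · by_cases hwT : w ∈ T <;> simp [payment, hvT, hvU, hv, hwU, hwT] <;> split_ifs <;> omega)
    refine le_trans ?_ this
    rw [nsmul_eq_mul]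
    omega
  have h0 := sum_sub_swap_eq_zero (G := G) S (payment G T U D)
  rw [hS, union_assoc, sum_union (disjoint_union_right.2 ⟨hTU, hTD⟩), sum_union hUD,
    ← union_assoc, ← hS] at h0
  have h1 := sum_le_sum fun v hv => le_charge_add_payments hS hTU hTD hUD hdeg (v := v) hv
  have h2 := sum_le_sum hU
  have h3 := sum_le_sum hD
  simp only [sum_add_distrib, sum_const, nsmul_eq_mul, ← mul_sum] at h1 h2 h3
  rw [sum_union hUD]
  linarith

variable [Fintype V]

/-- Both sides count the edges between `F` and its complement, which cancel in the difference. -/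
theorem sum_degreeIn_sub_compl (hG : G.IsRegularOfDegree 4) (F : Finset V) :
    ∑ v ∈ univ \ F, (degreeIn G (univ \ F) v : ℤ) - ∑ v ∈ F, (degreeIn G F v : ℤ) =
      4 * #(univ \ F) - 4 * #F := by
  have hdeg : ∀ v, (degreeIn G (univ \ F) v : ℤ) + degreeIn G F v = 4 := by
    intro v
    have h := degreeIn_sdiff_add (G := G) (subset_univ F) v
    rw [degreeIn_univ, hG.degree_eq] at h
    exact_mod_cast h
  have hswap : ∑ v ∈ univ \ F, (degreeIn G F v : ℤ) = ∑ v ∈ F, (degreeIn G (univ \ F) v : ℤ) := by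
    simp only [degreeIn, card_filter, Nat.cast_sum]
    rw [sum_comm]
    simp only [G.adj_comm]
  have h1 : ∑ v ∈ univ \ F, ((degreeIn G (univ \ F) v : ℤ) + degreeIn G F v) =
      4 * #(univ \ F) := by
    rw [sum_congr rfl fun v _ => hdeg v, sum_const, nsmul_eq_mul, mul_comm]
  have h2 : ∑ v ∈ F, ((degreeIn G (univ \ F) v : ℤ) + degreeIn G F v) = 4 * #F := by
    rw [sum_congr rfl fun v _ => hdeg v, sum_const, nsmul_eq_mul, mul_comm]
  rw [sum_add_distrib] at h1 h2
  linarith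

/-- The linear inequality behind the approximation ratio `50 / 27`. -/
theorem exists_noP4_sdiff_card_le (hG : G.IsRegularOfDegree 4) {S F : Finset V}
    (hdeg : ∀ v ∈ S, degreeIn G S v ≤ 2) (hF : NoP4 G (univ \ F)) :
    ∃ U ⊆ S, NoP4 G (S \ U) ∧ 15 * (#(univ \ S) + #U) + 12 * #S ≤ 50 * #F := by
  obtain ⟨U, hUX, hU, hess⟩ := exists_minimal_noP4 (G := G) (S := S) (F ∩ S) inter_subset_right
    (noP4_mono (fun x => by simp) hF)
  refine ⟨U, hUX.trans inter_subset_right, hU, ?_⟩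
  have hTS : S \ F ⊆ S := sdiff_subset
  have hTD : S \ F ∪ (F ∩ S) \ U = S \ U := by
    ext x
    have := @hUX x
    simp only [mem_union, mem_sdiff, mem_inter] at this ⊢
    tauto
  have hUD : U ∪ (F ∩ S) \ U = F ∩ S := union_sdiff_of_subset hUX
  have h1 := card_le_add_sum_charge (G := G) (S := S) (T := S \ F) (U := U) (D := (F ∩ S) \ U)
    (by rw [union_assoc, hUD, inter_comm, sdiff_union_inter])
    (disjoint_left.2 fun x hx hxU => (mem_sdiff.1 hx).2 (mem_inter.1 (hUX hxU)).1)
    (disjoint_left.2 fun x hx hxU => (mem_sdiff.1 hx).2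
      (mem_inter.1 (mem_sdiff.1 hxU).1).1) disjoint_sdiff hdeg (by rwa [hTD]) (by rwa [hTD])
  rw [hUD] at h1
  have h2 := sum_charge_le (G := G) (R := univ \ F) (T := S \ F)
    (sdiff_subset_sdiff (subset_univ _) Subset.rfl) hF
    (fun v _ => (degreeIn_mono (subset_univ _) v).trans_eq (by rw [degreeIn_univ, hG.degree_eq]))
    (fun v hv => (degreeIn_mono hTS v).trans (hdeg v (hTS hv)))
  have h3 := sum_degreeIn_sub_compl hG F
  have h4 : ∑ v ∈ F ∩ S, (degreeIn G (F ∩ S) v : ℤ) ≤ ∑ v ∈ F, (degreeIn G F v : ℤ) :=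
    (sum_le_sum fun v _ => by exact_mod_cast degreeIn_mono inter_subset_left v).trans
      (sum_le_sum_of_subset_of_nonneg inter_subset_left fun _ _ _ => by positivity)
  have c1 := card_sdiff_add_card_eq_card (subset_univ F)
  have c2 := card_sdiff_add_card_eq_card (subset_univ S)
  have c3 := card_sdiff_add_card_eq_card hUX
  have c4 := card_sdiff_add_card_inter S F
  rw [inter_comm] at c4
  zify at c1 c2 c3 c4 ⊢
  -- Adding `h1`, `h2` and 35 times `h3` and `h4`, then substituting the cardinalities, gives four
  -- times the goal.
  linarith

/-! ### Analysis of the algorithm -/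

/-- `A` and `B` are independent, and a vertex of `B` keeps three neighbours outside `A ∪ B`, so it
has at most one inside. One of the two inner vertices of a 4-path in `A ∪ B` would lie in `B` and
have two. -/
theorem noP4_union_of_greedyPhases (hG : G.IsRegularOfDegree 4) {A B : Finset V}
    (hA : GreedyPhase G 4 univ A) (hB : GreedyPhase G 3 (univ \ A) B) :
    NoP4 G (A ∪ B) ∧ ∀ v ∈ univ \ (A ∪ B), degreeIn G (univ \ (A ∪ B)) v ≤ 2 := by
  have h4 : ∀ v, degreeIn G univ v = 4 := fun v => by rw [degreeIn_univ, hG.degree_eq]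
  obtain ⟨indA, -⟩ := hA.degreeIn_eq fun v _ => (h4 v).le
  have h3 : ∀ v ∈ univ \ A, degreeIn G (univ \ A) v ≤ 3 := by
    intro v hv
    have h1 := hA.degreeIn_ne v hv
    have h2 := degreeIn_mono (G := G) (subset_univ (univ \ A)) v
    have := h4 v
    omega
  obtain ⟨indB, dB⟩ := hB.degreeIn_eq h3
  have hset : univ \ (A ∪ B) = (univ \ A) \ B := by rw [sdiff_sdiff_left]; rfl
  refine ⟨?_, ?_⟩
  · have key : ∀ a ∈ A, ∀ b ∈ B, ∀ c ∈ A, G.Adj b a → G.Adj b c → a ≠ c → False := by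
      intro a ha b hb c hc hba hbc hac
      have h1 := degreeIn_sdiff_add (G := G) hB.subset b
      have h2 := degreeIn_sdiff_add (G := G) (subset_univ A) b
      have h5 : 2 ≤ degreeIn G A b := by
        rw [← card_pair hac]
        apply card_le_card
        intro x hx
        rcases mem_insert.1 hx with rfl | hx
        · simp [ha, hba]
        · rw [mem_singleton.1 hx]; simp [hc, hbc]
      have := dB b hb
      have := h4 b
      omega
    have mid : ∀ a ∈ A ∪ B, ∀ b ∈ B, ∀ c ∈ A ∪ B, G.Adj b a → G.Adj b c → a ≠ c → False := by
      intro a ha b hb c hc hba hbc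
      exact key a ((mem_union.1 ha).resolve_right fun h => indB b hb a h hba) b hb c
        ((mem_union.1 hc).resolve_right fun h => indB b hb c h hbc) hba hbc
    intro a ha b hb c hc d hd hab hbc hcd hac hbd _
    rcases mem_union.1 hb with hbA | hbB
    · rcases mem_union.1 hc with hcA | hcB
      · exact indA b hbA c hcA hbc
      · exact mid b hb c hcB d hd hbc.symm hcd hbd
    · exact mid a ha b hbB c hc hab.symm hbc hac
  · intro v hv
    rw [hset] at hv ⊢
    have h1 := hB.degreeIn_ne v hv
    have h2 := degreeIn_mono (G := G) (sdiff_subset (s := univ \ A) (t := B)) v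
    have := h3 v (mem_sdiff.1 hv).1
    omega

theorem outside_one_two (W : ℕ → Finset V) : outside W 1 (4 - 2) = univ \ (W 1 ∪ W 2) := by
  rw [outside, show Icc 1 (4 - 2) = {1, 2} from rfl, biUnion_insert, singleton_biUnion]

theorem isApprox2Output_four_iff (A : Finset V) :
    IsApprox2Output G 4 A ↔ ∃ (W : ℕ → Finset V)
      (U : Finset ((outside W 1 (4 - 2) : Finset V) : Set V)),
      (GreedyPhase G 4 univ (W 1) ∧ GreedyPhase G 3 (univ \ W 1) (W 2)) ∧
      IsMinCover (G.induce ((outside W 1 (4 - 2) : Finset V) : Set V)) 4 U ∧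
      (A = U.map (Function.Embedding.subtype _) ∪ (W 1 ∪ W 2) ∨ A = univ \ (W 1 ∪ W 2)) ∧
      #A ≤ #(U.map (Function.Embedding.subtype _) ∪ (W 1 ∪ W 2)) ∧
      #A ≤ #(univ \ (W 1 ∪ W 2)) := by
  have hc : ∀ (W : ℕ → Finset V) (U : Finset V),
      candidates 4 W U = {U ∪ (W 1 ∪ W 2), univ \ (W 1 ∪ W 2)} := by
    intro W U
    rw [candidates, show Icc 1 (4 - 2) = {1, 2} from rfl, biUnion_insert, singleton_biUnion,
      show Icc 1 (4 / 2 - 1) = {1} from rfl, image_singleton]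
  have hg : ∀ W : ℕ → Finset V,
      (∀ i ∈ Icc 1 (4 - 2), GreedyPhase G (4 - i + 1) (outside W 1 (i - 1)) (W i)) ↔
        GreedyPhase G 4 univ (W 1) ∧ GreedyPhase G 3 (univ \ W 1) (W 2) := by
    intro W
    rw [show Icc 1 (4 - 2) = {1, 2} from rfl]
    simp [outside]
  simp only [IsApprox2Output, hc, hg, mem_insert, mem_singleton, forall_eq_or_imp, forall_eq]

theorem exists_isApprox2Output_four : ∃ A : Finset V, IsApprox2Output G 4 A := by
  obtain ⟨A, hA⟩ := exists_greedyPhase (G := G) 4 univ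
  obtain ⟨B, hB⟩ := exists_greedyPhase (G := G) 3 (univ \ A)
  let W : ℕ → Finset V := fun i => if i = 1 then A else B
  obtain ⟨U, hU, -⟩ := exists_isMinCover
    (G.induce ((outside W 1 (4 - 2) : Finset V) : Set V)) (k := 4) (by norm_num)
  rcases le_total #(U.map (Function.Embedding.subtype _) ∪ (W 1 ∪ W 2)) #(univ \ (W 1 ∪ W 2))
    with h | h
  · exact ⟨_, (isApprox2Output_four_iff _).2 ⟨W, U, ⟨hA, hB⟩, hU, Or.inl rfl, le_rfl, h⟩⟩
  · exact ⟨_, (isApprox2Output_four_iff _).2 ⟨W, U, ⟨hA, hB⟩, hU, Or.inr rfl, h, le_rfl⟩⟩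

theorem IsApprox2Output.isCover_and_card_le (hG : G.IsRegularOfDegree 4) {A : Finset V}
    (h : IsApprox2Output G 4 A) : IsCover G 4 A ∧ 27 * #A ≤ 50 * psi G 4 := by
  obtain ⟨W, U, ⟨hW1, hW2⟩, ⟨hU, hmin⟩, hA, hle1, hle2⟩ := (isApprox2Output_four_iff _).1 h
  obtain ⟨hP, hdeg⟩ := noP4_union_of_greedyPhases hG hW1 hW2
  rw [isCover_induce_four_iff] at hU
  have hout := outside_one_two W
  refine ⟨?_, ?_⟩
  · rw [isCover_four_iff]
    rcases hA with rfl | rfl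
    · refine noP4_mono (fun x hx => ?_) hU
      simp only [mem_sdiff, mem_union, not_or] at hx ⊢
      refine ⟨?_, hx.2.1⟩
      rw [hout]
      simpa using hx.2.2
    · rwa [Finset.sdiff_sdiff_eq_self (subset_univ _)]
  · obtain ⟨F, ⟨hF, -⟩, hFc⟩ := exists_isMinCover G (k := 4) (by norm_num)
    rw [isCover_four_iff] at hF
    rw [← hout] at hdeg
    obtain ⟨U', hU'S, hU', hcard⟩ := exists_noP4_sdiff_card_le hG hdeg hF
    have hmap : (U'.subtype (· ∈ ((outside W 1 (4 - 2) : Finset V) : Set V))).map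
        (Function.Embedding.subtype _) = U' :=
      subtype_map_of_mem fun x hx => hU'S hx
    have hle := hmin (U'.subtype (· ∈ ((outside W 1 (4 - 2) : Finset V) : Set V)))
      ((isCover_induce_four_iff _ _ _).2 (by rw [hmap]; exact hU'))
    have hc := congrArg card hmap
    rw [card_map] at hc
    have hu := card_union_le (U.map (Function.Embedding.subtype _)) (W 1 ∪ W 2)
    rw [card_map] at hu
    rw [hout, Finset.sdiff_sdiff_eq_self (subset_univ _)] at hcard
    -- Here 27 = 15 + 12: weight 15 goes to the bound by `U` with `W 1 ∪ W 2`, weight 12 to the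
    -- bound by the remaining vertices; optimality lets `U` replace `U'`.
    omega

end

end PathCover

theorem theorem5 {V : Type*} [Fintype V] [DecidableEq V] (G : SimpleGraph V) [DecidableRel G.Adj]
    (hG : G.IsRegularOfDegree 4) :
    (∃ A : Finset V, PathCover.IsApprox2Output G 4 A) ∧
    ∀ A : Finset V, PathCover.IsApprox2Output G 4 A →
      PathCover.IsCover G 4 A ∧ (A.card : ℝ) ≤ 1.852 * (PathCover.psi G 4 : ℝ) := by
  refine ⟨PathCover.exists_isApprox2Output_four, fun A hA => ?_⟩
  obtain ⟨hcov, hcard⟩ := hA.isCover_and_card_le hG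
  refine ⟨hcov, ?_⟩
  have h : (27 : ℝ) * A.card ≤ 50 * PathCover.psi G 4 := by exact_mod_cast hcard
  have : (0 : ℝ) ≤ PathCover.psi G 4 := Nat.cast_nonneg _
  linarith
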